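/- Let $n\in\mathbb N$, $k_A,k_B,k_C>0$, and let $\omega:[0,1]\to[0,1]$ be a modulus of continuity (continuous, increasing, concave, $\omega(0)=0$) satisfying the Osgood condition $\int_0^1\frac{ds}{\omega(s)}=+\infty$. For $T>0$ consider operators $$\mathcal Lu=\partial_tu+\sum_{i,j=1}^n\partial_{x_i}\big(a_{i,j}(t)\partial_{x_j}u\big)+\sum_{j=1}^nb_j(t)\partial_{x_j}u+c(t)u\qquad\text{on }[0,T]\times\mathbb R^n,$$ with $a_{i,j}$ real and $b_j,c$ complex valued, such that for all $t\in[0,T]$, $\xi\in\mathbb R^n$ and all $i,j$: $a_{i,j}(t)=a_{j,i}(t)$; $k_A|\xi|^2\le\sum_{i,j}a_{i,j}(t)\xi_i\xi_j\le k_A^{-1}|\xi|^2$; $|b_j(t)|\le k_B$; $|c(t)|\le k_C$; and $a_{i,j}\in C^\omega([0,T])$, i.e. $|a_{i,j}(t)-a_{i,j}(s)|\le M\,\omega(|t-s|)$ for some $M$ and all $s,t\in[0,T]$ with $0<|t-s|<1$. Call such operators admissible. Let $\mathcal H_0=C([0,T],L^2(\mathbb R^n))\cap C([0,T[,H^1(\mathbb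 R^n))\cap C^1([0,T[,L^2(\mathbb R^n))$ (complex valued functions), and, with $\hat f(\xi)=(2\pi)^{-n/2}\int e^{-ix\cdot\xi}f(x)\,dx$, $$\|f\|_{H^1}^2=\int_{\mathbb R^n}(1+|\xi|^2)|\hat f(\xi)|^2d\xi,\qquad \|f\|^2_{H^0_{\nu,\epsilon}}=\int_{\mathbb R^n}e^{2\nu|\xi|^{1/\epsilon}}|\hat f(\xi)|^2d\xi\in[0,+\infty].$$ The equation $\mathcal Lu=0$ is understood in the sense of distributions in $x$ for almost every $t\in\,]0,T[$. Theorem. There exists $\alpha_1>0$, depending only on $k_A,k_B,k_C,\omega,n$, such that for all $0<T''<T$ there exist constants $0<\rho\le k_A$ and $C>0$, depending only on $k_A,k_B,k_C,\omega,n,T,T''$, and, for all $\nu>0$ and $\epsilon>1$, a strictly decreasing function $g:\,]0,k_A]\to[0,+\infty[$ with $\lim_{y\to0}g(y)=+\infty$, depending only on $k_A,k_B,k_C,\omega,n,T,T'',\nu,\epsilon$, with the following property. Put $\sigma=\min\{T'',1/\alpha_1\}$ and $\bar\sigma=\sigma/8$. If $\mathcal L$ is admissible, $u\in\mathcal H_0$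 solves $\mathcal Lu=0$ and $\|u(0,\cdot)\|^2_{H^0_{\nu,\epsilon}}<\rho$, then $$\sup_{z\in[0,\bar\sigma]}\|u(z,\cdot)\|^2_{H^1}\le C\,e^{-\sigma g\left(\|u(0,\cdot)\|^2_{H^0_{\nu,\epsilon}}\right)}\left[1+\|u(\sigma,\cdot)\|^2_{H^1}\right],$$ where for $u(0,\cdot)=0$ the right-hand side is read as $0$ (i.e. $g(0)=+\infty$, $e^{-\infty}=0$), so that then $u(z,\cdot)=0$ for all $z\in[0,\bar\sigma]$. -/

import Mathlib

open MeasureTheory Set Filter Topology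
open scoped ENNReal FourierTransform LineDeriv SchwartzMap

noncomputable section

namespace BackwardParabolic

/-- The Euclidean space `ℝⁿ`. -/
abbrev Rn (n : ℕ) : Type := EuclideanSpace ℝ (Fin n)

/-- The space `L²(ℝⁿ)` (complex valued, so that real valued functions are included). -/
abbrev L2 (n : ℕ) : Type := Lp ℂ 2 (volume : Measure (Rn n))

/-- A modulus of continuity: a function `ω : [0,1] → [0,1]` which is continuous, (weakly)
increasing, concave and vanishes at `0`. Only the values of `ω` on `[0,1]` matter. -/
structure IsModulusOfContinuity (ω : ℝ → ℝ) : Prop where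
  mapsTo : MapsTo ω (Icc 0 1) (Icc 0 1)
  continuousOn : ContinuousOn ω (Icc 0 1)
  monotoneOn : MonotoneOn ω (Icc 0 1)
  concaveOn : ConcaveOn ℝ (Icc 0 1) ω
  map_zero : ω 0 = 0

/-- The Osgood condition `∫₀¹ ds / ω(s) = +∞`. -/
def Osgood (ω : ℝ → ℝ) : Prop :=
  ∫⁻ s in Ioo (0 : ℝ) 1, (ENNReal.ofReal (ω s))⁻¹ = ∞

/-- `f ∈ C^ω([0,T])`: the quotients `|f(t) - f(s)| / ω(|t - s|)`, `0 < |t - s| < 1`,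
are bounded. -/
def HasRegularity (ω : ℝ → ℝ) (T : ℝ) (f : ℝ → ℝ) : Prop :=
  ∃ M : ℝ, ∀ t ∈ Icc 0 T, ∀ s ∈ Icc 0 T, 0 < |t - s| → |t - s| < 1 →
    |f t - f s| ≤ M * ω |t - s|

/-- The assumptions on the coefficients of
`𝓛 u = ∂ₜ u + ∑ᵢⱼ ∂ᵢ (aᵢⱼ(t) ∂ⱼ u) + ∑ⱼ bⱼ(t) ∂ⱼ u + c(t) u` on `[0,T] × ℝⁿ`. -/
structure IsAdmissible {n : ℕ} (T kA kB kC : ℝ) (ω : ℝ → ℝ)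
    (a : ℝ → Matrix (Fin n) (Fin n) ℝ) (b : ℝ → Fin n → ℂ) (c : ℝ → ℂ) : Prop where
  symm : ∀ t ∈ Icc 0 T, ∀ i j, a t i j = a t j i
  lower : ∀ t ∈ Icc 0 T, ∀ ξ : Rn n, kA * ‖ξ‖ ^ 2 ≤ ∑ i, ∑ j, a t i j * ξ i * ξ j
  upper : ∀ t ∈ Icc 0 T, ∀ ξ : Rn n, ∑ i, ∑ j, a t i j * ξ i * ξ j ≤ kA⁻¹ * ‖ξ‖ ^ 2
  bound_b : ∀ t ∈ Icc 0 T, ∀ i, ‖b t i‖ ≤ kB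
  bound_c : ∀ t ∈ Icc 0 T, ‖c t‖ ≤ kC
  regular : ∀ i j, HasRegularity ω T (fun t => a t i j)

/-- The Fourier transform of `f ∈ L²(ℝⁿ)` in the unitary angular-frequency normalization
`f̂(ξ) = (2π)^(-n/2) ∫ e^(-i x·ξ) f(x) dx`, for which `∂ⱼ` becomes multiplication by `i ξⱼ`.
(Mathlib's `𝓕` has the kernel `e^(-2πi x·ξ)`.) -/
def fourierHat {n : ℕ} (f : L2 n) (ξ : Rn n) : ℂ :=
  (((2 * Real.pi) ^ (-(n : ℝ) / 2) : ℝ) : ℂ) * (𝓕 f : L2 n) ((2 * Real.pi)⁻¹ • ξ)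

/-- The squared Gevrey-Sobolev norm of `H^d_{a,ε}(ℝⁿ)`,
`∫ (1 + |ξ|²)^d e^(2a|ξ|^(1/ε)) |f̂(ξ)|² dξ ∈ [0,∞]`. -/
def gevreyNormSq {n : ℕ} (d a ε : ℝ) (f : L2 n) : ℝ≥0∞ :=
  ∫⁻ ξ : Rn n, ENNReal.ofReal ((1 + ‖ξ‖ ^ 2) ^ d * Real.exp (2 * a * ‖ξ‖ ^ (1 / ε))) *
    ‖fourierHat f ξ‖ₑ ^ 2

/-- The squared norm of `H¹(ℝⁿ)`, `∫ (1 + |ξ|²) |f̂(ξ)|² dξ ∈ [0,∞]`; a function of `L²` belongs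
to `H¹` if and only if this is finite. -/
def sobolevNormSq {n : ℕ} (f : L2 n) : ℝ≥0∞ :=
  ∫⁻ ξ : Rn n, ENNReal.ofReal (1 + ‖ξ‖ ^ 2) * ‖fourierHat f ξ‖ₑ ^ 2

/-- The space `C([0,T], L²) ∩ C([0,T[, H¹) ∩ C¹([0,T[, L²)`. -/
structure MemH0 {n : ℕ} (T : ℝ) (u : ℝ → L2 n) : Prop where
  continuousOn : ContinuousOn u (Icc 0 T)
  mem_sobolev : ∀ t ∈ Ico 0 T, sobolevNormSq (u t) < ∞
  continuousOn_sobolev : ∀ t ∈ Ico 0 T,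
    Tendsto (fun s => sobolevNormSq (u s - u t)) (𝓝[Ico 0 T] t) (𝓝 0)
  contDiffOn : ContDiffOn ℝ 1 u (Ico 0 T)

/-- The spatial derivative `∂ᵢ` of tempered distributions on `ℝⁿ`. -/
def partialD {n : ℕ} (i : Fin n) (f : 𝓢'(Rn n, ℂ)) : 𝓢'(Rn n, ℂ) :=
  ∂_{(EuclideanSpace.single i (1 : ℝ) : Rn n)} f

/-- `𝓛 u = 0` on `]0,T[ × ℝⁿ`: for almost every `t ∈ ]0,T[`,
`∂ₜ u + ∑ᵢⱼ ∂ᵢ (aᵢⱼ(t) ∂ⱼ u) + ∑ⱼ bⱼ(t) ∂ⱼ u + c(t) u = 0` holds in the sense of tempered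
distributions on `ℝⁿ`, where `∂ₜ u` is the derivative of the `L²`-valued function `u`. -/
def IsSolution {n : ℕ} (T : ℝ) (a : ℝ → Matrix (Fin n) (Fin n) ℝ) (b : ℝ → Fin n → ℂ)
    (c : ℝ → ℂ) (u : ℝ → L2 n) : Prop :=
  ∀ᵐ t : ℝ, t ∈ Ioo 0 T →
    (Lp.toTemperedDistribution (deriv u t) : 𝓢'(Rn n, ℂ))
      + ∑ i, ∑ j, partialD i ((a t i j : ℂ) • partialD j (Lp.toTemperedDistribution (u t)))
      + ∑ j, b t j • partialD j (Lp.toTemperedDistribution (u t))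
      + c t • (Lp.toTemperedDistribution (u t) : 𝓢'(Rn n, ℂ)) = 0

end BackwardParabolic

end

/-!
Since the coefficients do not depend on `x`, the Fourier transform decouples the frequencies: at
almost every `ξ`, `|û(t, ξ)|²` satisfies a scalar linear differential equation whose growth rate is
at least `kA |ξ|² - D` and at most `K (1 + |ξ|²)`. Below a threshold `|ξ|² ≤ s`, `û(z)` is therefore
controlled by the initial datum with a loss `exp (B (1 + s))`; above it, by `û(σ)` with a gain
`exp (-kA (σ - z) s)`. Choosing `s` of the order of `-log ‖u(0)‖²` balances the two into a Hölder
estimate `‖u(z)‖²_{H¹} ≤ C ‖u(0)‖^{2θ} (1 + ‖u(σ)‖²_{H¹})`, so that `g` can be taken logarithmic.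
-/

namespace BackwardParabolic

section Gronwall

theorem forall_mem_le_of_ae_restrict_le {X Y : Type*} [TopologicalSpace X] [MeasurableSpace X]
    {μ : Measure X} [μ.IsOpenPosMeasure] [TopologicalSpace Y] [LinearOrder Y]
    [OrderClosedTopology Y] {U : Set X} (hU : IsOpen U) {f g : X → Y} (hf : ContinuousOn f U)
    (hg : ContinuousOn g U) (h : f ≤ᵐ[μ.restrict U] g) : ∀ x ∈ U, f x ≤ g x := by
  have hmin : (fun x => min (f x) (g x)) =ᵐ[μ.restrict U] f := h.mono fun x hx => min_eq_left hx
  exact fun x hx =>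
    min_eq_left_iff.1 (Measure.eqOn_open_of_ae_eq hmin hU (hf.inf hg) hf hx)

theorem exp_mul_le_of_mul_le_deriv {f f' : ℝ → ℝ} {κ s t : ℝ} (hst : s ≤ t)
    (hf : ContinuousOn f (Icc s t)) (hf' : ∀ τ ∈ Ioo s t, HasDerivAt f (f' τ) τ)
    (h : ∀ τ ∈ Ioo s t, κ * f τ ≤ f' τ) : Real.exp (κ * (t - s)) * f s ≤ f t := by
  have hderiv : ∀ τ ∈ Ioo s t, HasDerivAt (fun τ => Real.exp (κ * (t - τ)) * f τ)
      (Real.exp (κ * (t - τ)) * (f' τ - κ * f τ)) τ := fun τ hτ =>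
    ((((hasDerivAt_id τ).const_sub t).const_mul κ).exp.mul (hf' τ hτ)).congr_deriv
      (by simp only [id]; ring)
  have hmono : MonotoneOn (fun τ => Real.exp (κ * (t - τ)) * f τ) (Icc s t) := by
    refine monotoneOn_of_deriv_nonneg (convex_Icc s t) (ContinuousOn.mul (by fun_prop) hf) ?_ ?_ <;>
      rw [interior_Icc]
    · exact fun τ hτ => (hderiv τ hτ).differentiableAt.differentiableWithinAt
    · intro τ hτ
      rw [(hderiv τ hτ).deriv]
      exact mul_nonneg (Real.exp_pos _).le (sub_nonneg.2 (h τ hτ))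
  simpa using hmono (left_mem_Icc.2 hst) (right_mem_Icc.2 hst) hst

theorem exp_mul_norm_sq_le {H : Type*} [NormedAddCommGroup H] [InnerProductSpace ℝ H] {v : ℝ → H}
    {κ s t : ℝ} (hst : s ≤ t) (hv : ContinuousOn v (Icc s t)) (hv' : ContDiffOn ℝ 1 v (Ioo s t))
    (h : ∀ᵐ τ, τ ∈ Ioo s t → κ * ‖v τ‖ ^ 2 ≤ 2 * inner ℝ (v τ) (deriv v τ)) :
    Real.exp (κ * (t - s)) * ‖v s‖ ^ 2 ≤ ‖v t‖ ^ 2 := by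
  have hderiv : ContinuousOn (deriv v) (Ioo s t) :=
    hv'.continuousOn_deriv_of_isOpen isOpen_Ioo le_rfl
  have hvI : ContinuousOn v (Ioo s t) := hv.mono Ioo_subset_Icc_self
  refine exp_mul_le_of_mul_le_deriv (f := fun τ => ‖v τ‖ ^ 2)
    (f' := fun τ => 2 * inner ℝ (v τ) (deriv v τ)) hst (hv.norm.pow 2) (fun τ hτ => ?_) ?_
  · exact ((hv'.differentiableOn one_ne_zero).differentiableAt
      (isOpen_Ioo.mem_nhds hτ)).hasDerivAt.norm_sq
  · exact forall_mem_le_of_ae_restrict_le isOpen_Ioo (continuousOn_const.mul (hvI.norm.pow 2))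
      (continuousOn_const.mul (hvI.inner hderiv)) ((ae_restrict_iff' measurableSet_Ioo).2 h)

end Gronwall

section PointwiseGrowth

variable {α E : Type*} [MeasurableSpace α] {μ : Measure α} [NormedAddCommGroup E]

theorem integrable_norm_sq (f : Lp E 2 μ) : Integrable (fun x => ‖f x‖ ^ 2) μ :=
  (Lp.memLp f).integrable_norm_pow two_ne_zero

variable [InnerProductSpace ℝ E]

theorem inner_LpToLpRestrictCLM (S : Set α) (f g : Lp E 2 μ) :
    inner ℝ (LpToLpRestrictCLM α E ℝ μ 2 S f) (LpToLpRestrictCLM α E ℝ μ 2 S g) =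
      ∫ x in S, inner ℝ (f x) (g x) ∂μ := by
  rw [L2.inner_def]
  refine integral_congr_ae ?_
  filter_upwards [LpToLpRestrictCLM_coeFn ℝ S f, LpToLpRestrictCLM_coeFn ℝ S g] with x hf hg
  rw [hf, hg]

theorem norm_sq_LpToLpRestrictCLM (S : Set α) (f : Lp E 2 μ) :
    ‖LpToLpRestrictCLM α E ℝ μ 2 S f‖ ^ 2 = ∫ x in S, ‖f x‖ ^ 2 ∂μ := by
  simp only [← real_inner_self_eq_norm_sq, inner_LpToLpRestrictCLM]

variable {v : ℝ → Lp E 2 μ} {s t : ℝ}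

theorem exp_mul_setIntegral_norm_sq_le {κ : ℝ} (hst : s ≤ t) (hv : ContinuousOn v (Icc s t))
    (hv' : ContDiffOn ℝ 1 v (Ioo s t)) {S : Set α}
    (h : ∀ᵐ τ, τ ∈ Ioo s t →
      ∀ᵐ x ∂μ.restrict S, κ * ‖v τ x‖ ^ 2 ≤ 2 * inner ℝ (v τ x) (deriv v τ x)) :
    Real.exp (κ * (t - s)) * ∫ x in S, ‖v s x‖ ^ 2 ∂μ ≤ ∫ x in S, ‖v t x‖ ^ 2 ∂μ := by
  let R := LpToLpRestrictCLM α E ℝ μ 2 S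
  simp only [← norm_sq_LpToLpRestrictCLM]
  refine exp_mul_norm_sq_le (v := fun τ => R (v τ)) hst (R.continuous.comp_continuousOn hv)
    (R.contDiff.comp_contDiffOn hv') ?_
  filter_upwards [h] with τ h hτ
  have hderiv : deriv (fun τ => R (v τ)) τ = R (deriv v τ) :=
    (R.hasFDerivAt.comp_hasDerivAt τ ((hv'.differentiableOn one_ne_zero).differentiableAt
      (isOpen_Ioo.mem_nhds hτ)).hasDerivAt).deriv
  rw [hderiv, norm_sq_LpToLpRestrictCLM, inner_LpToLpRestrictCLM, ← integral_const_mul,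
    ← integral_const_mul]
  exact integral_mono_ae ((integrable_norm_sq _).restrict.const_mul _)
    ((L2.integrable_inner (𝕜 := ℝ) _ _).restrict.const_mul _) (h hτ)

theorem ae_exp_mul_norm_sq_le {κ : α → ℝ} (hκ : Measurable κ) (hst : s ≤ t)
    (hv : ContinuousOn v (Icc s t)) (hv' : ContDiffOn ℝ 1 v (Ioo s t))
    (h : ∀ᵐ τ, τ ∈ Ioo s t → ∀ᵐ x ∂μ, κ x * ‖v τ x‖ ^ 2 ≤ 2 * inner ℝ (v τ x) (deriv v τ x)) :
    ∀ᵐ x ∂μ, Real.exp (κ x * (t - s)) * ‖v s x‖ ^ 2 ≤ ‖v t x‖ ^ 2 := by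
  -- On `{q ≤ κ}` the constant rate `q` applies, and countably many `q` exhaust `κ` from below.
  have hrat (q : ℚ) :
      ∀ᵐ x ∂μ, q ≤ κ x → Real.exp (q * (t - s)) * ‖v s x‖ ^ 2 ≤ ‖v t x‖ ^ 2 := by
    have hS : MeasurableSet {x | (q : ℝ) ≤ κ x} := measurableSet_le measurable_const hκ
    refine (ae_restrict_iff' hS).1 (ae_le_of_forall_setIntegral_le
      ((integrable_norm_sq _).restrict.const_mul _) (integrable_norm_sq _).restrict
      fun S' hS' _ => ?_)
    rw [Measure.restrict_restrict hS', integral_const_mul]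
    refine exp_mul_setIntegral_norm_sq_le hst hv hv' ?_
    filter_upwards [h] with τ h hτ
    filter_upwards [ae_restrict_of_ae (h hτ), ae_restrict_mem (hS'.inter hS)] with x hx hxS
    exact (mul_le_mul_of_nonneg_right hxS.2 (sq_nonneg _)).trans hx
  filter_upwards [ae_all_iff.2 hrat] with x hx
  obtain ⟨q, -, hq, hlim⟩ := Real.exists_seq_rat_strictMono_tendsto (κ x)
  exact le_of_tendsto (((Real.continuous_exp.tendsto _).comp (hlim.mul_const _)).mul_const _)
    (Eventually.of_forall fun k => hx (q k) (hq k).le)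

theorem ae_norm_sq_le_exp_mul {κ : α → ℝ} (hκ : Measurable κ) (hst : s ≤ t)
    (hv : ContinuousOn v (Icc s t)) (hv' : ContDiffOn ℝ 1 v (Ioo s t))
    (h : ∀ᵐ τ, τ ∈ Ioo s t → ∀ᵐ x ∂μ, 2 * inner ℝ (v τ x) (deriv v τ x) ≤ κ x * ‖v τ x‖ ^ 2) :
    ∀ᵐ x ∂μ, ‖v t x‖ ^ 2 ≤ Real.exp (κ x * (t - s)) * ‖v s x‖ ^ 2 := by
  have hIcc : MapsTo (fun τ => s + t - τ) (Icc s t) (Icc s t) := fun τ hτ =>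
    ⟨by linarith [hτ.2], by linarith [hτ.1]⟩
  have hIoo : MapsTo (fun τ => s + t - τ) (Ioo s t) (Ioo s t) := fun τ hτ =>
    ⟨by linarith [hτ.2], by linarith [hτ.1]⟩
  have hreflect := (Measure.measurePreserving_sub_left volume (s + t)).quasiMeasurePreserving.ae h
  have hreversed : ∀ᵐ x ∂μ, Real.exp (-κ x * (t - s)) * ‖v t x‖ ^ 2 ≤ ‖v s x‖ ^ 2 := by
    have key := ae_exp_mul_norm_sq_le (v := fun τ => v (s + t - τ)) hκ.neg hst
      (hv.comp (by fun_prop) hIcc) (hv'.comp (by fun_prop) hIoo) <| by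
        filter_upwards [hreflect] with τ h hτ
        filter_upwards [h (hIoo hτ), Lp.coeFn_neg (deriv v (s + t - τ))] with x hx hneg
        rw [deriv_comp_const_sub, hneg, Pi.neg_apply, Pi.neg_apply, inner_neg_right]
        linarith
    simpa using key
  filter_upwards [hreversed] with x hx
  calc ‖v t x‖ ^ 2 = Real.exp (κ x * (t - s)) * (Real.exp (-κ x * (t - s)) * ‖v t x‖ ^ 2) := by
        rw [← mul_assoc, ← Real.exp_add]; simp
    _ ≤ Real.exp (κ x * (t - s)) * ‖v s x‖ ^ 2 := by gcongr

end PointwiseGrowth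

section FourierMultiplier

open TemperedDistribution

theorem ae_eq_smul_of_toTemperedDistribution_eq_smulLeftCLM {E F : Type*} [NormedAddCommGroup E]
    [NormedSpace ℝ E] [FiniteDimensional ℝ E] [MeasurableSpace E] [BorelSpace E]
    [NormedAddCommGroup F] [NormedSpace ℂ F] [CompleteSpace F] {μ : Measure E}
    [μ.HasTemperateGrowth] [IsLocallyFiniteMeasure μ] {p q : ℝ≥0∞} [hp : Fact (1 ≤ p)]
    [hq : Fact (1 ≤ q)] {m : E → ℂ} (hm : m.HasTemperateGrowth) {f : Lp F p μ} {g : Lp F q μ}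
    (h : Lp.toTemperedDistribution g =
      smulLeftCLM F m (Lp.toTemperedDistribution f)) :
    ∀ᵐ x ∂μ, g x = m x • f x := by
  have hf : LocallyIntegrable f μ := (Lp.memLp f).locallyIntegrable hp.out
  have hmf : LocallyIntegrable (fun x => m x • f x) μ := by
    rw [← locallyIntegrableOn_univ] at hf ⊢
    exact hf.continuousOn_smul isOpen_univ.isLocallyClosed hm.1.continuous.continuousOn
  refine ae_eq_of_integral_contDiff_smul_eq ((Lp.memLp g).locallyIntegrable hq.out) hmf
    fun φ hφ hφc => ?_
  have hφc' : HasCompactSupport (Complex.ofRealCLM ∘ φ) := hφc.comp_left rfl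
  have htest := DFunLike.congr_fun h (hφc'.toSchwartzMap (Complex.ofRealCLM.contDiff.comp hφ))
  simp only [smulLeftCLM_apply_apply, Lp.toTemperedDistribution_apply,
    SchwartzMap.smulLeftCLM_apply_apply hm] at htest
  simpa [mul_smul, smul_comm (m _)] using htest

variable {V F : Type*} [NormedAddCommGroup V] [InnerProductSpace ℝ V] [FiniteDimensional ℝ V]
  [MeasurableSpace V] [BorelSpace V] [NormedAddCommGroup F] [NormedSpace ℂ F] {g g₁ g₂ : V → ℂ}

theorem fourierMultiplierCLM_fun_add (hg₁ : g₁.HasTemperateGrowth)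
    (hg₂ : g₂.HasTemperateGrowth) :
    fourierMultiplierCLM F (fun η => g₁ η + g₂ η) =
      fourierMultiplierCLM F g₁ + fourierMultiplierCLM F g₂ := by
  rw [fourierMultiplierCLM, ← Pi.add_def, smulLeftCLM_add hg₁ hg₂]
  simp only [ContinuousLinearMap.add_comp, ContinuousLinearMap.comp_add, fourierMultiplierCLM]

theorem fourierMultiplierCLM_fun_neg (hg : g.HasTemperateGrowth) :
    fourierMultiplierCLM F (fun η => -g η) = -fourierMultiplierCLM F g := by
  rw [fourierMultiplierCLM, ← Pi.neg_def, smulLeftCLM_neg hg]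
  simp only [ContinuousLinearMap.neg_comp, ContinuousLinearMap.comp_neg, fourierMultiplierCLM]

theorem fourierMultiplierCLM_const_mul (hg : g.HasTemperateGrowth) (c : ℂ) :
    fourierMultiplierCLM F (fun η => c * g η) = c • fourierMultiplierCLM F g :=
  fourierMultiplierCLM_smul hg c

theorem ae_fourier_eq_smul_of_eq_fourierMultiplierCLM {H : Type*} [NormedAddCommGroup H]
    [InnerProductSpace ℂ H] [CompleteSpace H] (hg : g.HasTemperateGrowth)
    {f f' : Lp H 2 (volume : Measure V)}
    (h : (f' : 𝓢'(V, H)) = fourierMultiplierCLM H g (f : 𝓢'(V, H))) :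
    ∀ᵐ η, (𝓕 f' : Lp H 2 (volume : Measure V)) η =
      g η • (𝓕 f : Lp H 2 (volume : Measure V)) η := by
  refine ae_eq_smul_of_toTemperedDistribution_eq_smulLeftCLM hg ?_
  rw [← Lp.fourier_toTemperedDistribution_eq, h, fourierMultiplierCLM_apply,
    FourierTransform.fourier_fourierInv_eq, Lp.fourier_toTemperedDistribution_eq]

end FourierMultiplier

section Symbol

open TemperedDistribution

variable {n : ℕ}

/-- The symbol `∑ aᵢⱼ ξᵢ ξⱼ - i ∑ bⱼ ξⱼ - c` of the spatial part of `-𝓛`, in the angular frequency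
`ξ` of `fourierHat`. -/
def symbol (a : Matrix (Fin n) (Fin n) ℝ) (b : Fin n → ℂ) (c : ℂ) (ξ : Rn n) : ℂ :=
  ((∑ i, ∑ j, a i j * ξ i * ξ j : ℝ) : ℂ) - Complex.I * ∑ j, b j * ξ j - c

@[fun_prop]
theorem hasTemperateGrowth_coord (i : Fin n) :
    (fun η : Rn n => ((η i : ℝ) : ℂ)).HasTemperateGrowth :=
  (Complex.ofRealCLM.comp (EuclideanSpace.proj i)).hasTemperateGrowth

theorem partialD_eq_fourierMultiplierCLM (i : Fin n) (φ : 𝓢'(Rn n, ℂ)) :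
    partialD i φ = fourierMultiplierCLM ℂ (fun η => 2 * Real.pi * Complex.I * η i) φ := by
  rw [fourierMultiplierCLM_const_mul (hasTemperateGrowth_coord i), partialD,
    lineDeriv_eq_fourierMultiplierCLM]
  simp [EuclideanSpace.inner_single_right]

theorem partialD_smul_partialD_eq_fourierMultiplierCLM (i j : Fin n) (r : ℂ) (φ : 𝓢'(Rn n, ℂ)) :
    partialD i (r • partialD j φ) = fourierMultiplierCLM ℂ
      (fun η => r * ((2 * Real.pi * Complex.I * η j) * (2 * Real.pi * Complex.I * η i))) φ := by
  rw [fourierMultiplierCLM_const_mul (by fun_prop), partialD_eq_fourierMultiplierCLM,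
    partialD_eq_fourierMultiplierCLM, map_smul,
    fourierMultiplierCLM_fourierMultiplierCLM_apply (by fun_prop) (by fun_prop)]
  rfl

theorem smul_partialD_eq_fourierMultiplierCLM (j : Fin n) (r : ℂ) (φ : 𝓢'(Rn n, ℂ)) :
    r • partialD j φ =
      fourierMultiplierCLM ℂ (fun η => r * (2 * Real.pi * Complex.I * η j)) φ := by
  rw [fourierMultiplierCLM_const_mul (by fun_prop), partialD_eq_fourierMultiplierCLM, smul_apply]

variable {a : Matrix (Fin n) (Fin n) ℝ} {b : Fin n → ℂ} {c : ℂ}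

theorem neg_symbol_two_pi_smul (η : Rn n) :
    -symbol a b c ((2 * Real.pi) • η) =
      ∑ i, ∑ j, a i j * ((2 * Real.pi * Complex.I * η j) * (2 * Real.pi * Complex.I * η i)) +
        ∑ j, b j * (2 * Real.pi * Complex.I * η j) + c := by
  have hI (i j) : (a i j : ℂ) *
      ((2 * Real.pi * Complex.I * η j) * (2 * Real.pi * Complex.I * η i)) =
        -(a i j * (2 * Real.pi * η i) * (2 * Real.pi * η j)) := by
    linear_combination (a i j : ℂ) * 4 * Real.pi ^ 2 * η i * η j * Complex.I_sq
  have hI' (j) : b j * (2 * Real.pi * Complex.I * η j) =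
      Complex.I * (b j * (2 * Real.pi * η j)) := by ring
  simp only [symbol, hI, hI', PiLp.smul_apply, smul_eq_mul, Finset.sum_neg_distrib,
    ← Finset.mul_sum]
  push_cast
  ring

theorem hasTemperateGrowth_symbol_smul (r : ℝ) :
    (fun η => symbol a b c (r • η)).HasTemperateGrowth := by
  simp only [symbol, PiLp.smul_apply, smul_eq_mul]
  push_cast
  fun_prop

theorem spatial_eq_neg_fourierMultiplierCLM_symbol (φ : 𝓢'(Rn n, ℂ)) :
    ∑ i, ∑ j, partialD i ((a i j : ℂ) • partialD j φ) + ∑ j, b j • partialD j φ + c • φ =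
      -fourierMultiplierCLM ℂ (fun η => symbol a b c ((2 * Real.pi) • η)) φ := by
  rw [← neg_apply, ← fourierMultiplierCLM_fun_neg (hasTemperateGrowth_symbol_smul _)]
  simp only [neg_symbol_two_pi_smul]
  rw [fourierMultiplierCLM_fun_add (by fun_prop) (by fun_prop),
    fourierMultiplierCLM_fun_add (by fun_prop) (by fun_prop), fourierMultiplierCLM_const,
    fourierMultiplierCLM_sum ℂ fun _ _ => by fun_prop,
    fourierMultiplierCLM_sum ℂ fun _ _ => by fun_prop]
  simp only [partialD_smul_partialD_eq_fourierMultiplierCLM]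
  simp only [smul_partialD_eq_fourierMultiplierCLM, add_apply, sum_apply, smul_apply,
    ContinuousLinearMap.id_apply]
  congr! with i
  rw [fourierMultiplierCLM_sum ℂ fun _ _ => by fun_prop, sum_apply]

theorem ae_fourier_eq_symbol_mul {f f' : L2 n}
    (h : (Lp.toTemperedDistribution f' : 𝓢'(Rn n, ℂ))
      + ∑ i, ∑ j, partialD i ((a i j : ℂ) • partialD j (Lp.toTemperedDistribution f))
      + ∑ j, b j • partialD j (Lp.toTemperedDistribution f)
      + c • (Lp.toTemperedDistribution f : 𝓢'(Rn n, ℂ)) = 0) :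
    ∀ᵐ η, (𝓕 f' : L2 n) η = symbol a b c ((2 * Real.pi) • η) * (𝓕 f : L2 n) η := by
  refine ae_fourier_eq_smul_of_eq_fourierMultiplierCLM (hasTemperateGrowth_symbol_smul _) ?_
  rwa [add_assoc, add_assoc, ← add_assoc (∑ i, _), spatial_eq_neg_fourierMultiplierCLM_symbol,
    add_neg_eq_zero] at h

end Symbol

section FourierHat

theorem lintegral_enorm_sq {α E : Type*} [MeasurableSpace α] {μ : Measure α}
    [NormedAddCommGroup E] (f : Lp E 2 μ) : ∫⁻ x, ‖f x‖ₑ ^ 2 ∂μ = ‖f‖ₑ ^ 2 := by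
  rw [Lp.enorm_def]
  simpa using (eLpNorm_nnreal_pow_eq_lintegral (p := 2) two_ne_zero).symm

variable {n : ℕ}

theorem measurable_fourierHat (f : L2 n) : Measurable (fourierHat f) :=
  ((Lp.stronglyMeasurable (𝓕 f : L2 n)).measurable.comp
    (measurable_const_smul (2 * Real.pi)⁻¹)).const_mul _

theorem norm_sq_fourierHat (f : L2 n) (ξ : Rn n) :
    ‖fourierHat f ξ‖ ^ 2 =
      ((2 * Real.pi) ^ n)⁻¹ * ‖(𝓕 f : L2 n) ((2 * Real.pi)⁻¹ • ξ)‖ ^ 2 := by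
  have hpi : 0 ≤ 2 * Real.pi := by positivity
  rw [fourierHat, norm_mul, mul_pow, Complex.norm_real, Real.norm_of_nonneg (by positivity),
    ← Real.rpow_mul_natCast hpi, Nat.cast_ofNat, div_mul_cancel₀ _ two_ne_zero,
    Real.rpow_neg hpi, Real.rpow_natCast]

theorem lintegral_enorm_sq_fourierHat (f : L2 n) :
    ∫⁻ ξ, ‖fourierHat f ξ‖ₑ ^ 2 = ‖f‖ₑ ^ 2 := by
  have hfourier : ‖f‖ₑ ^ 2 = ∫⁻ η, ‖(𝓕 f : L2 n) η‖ₑ ^ 2 := by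
    rw [← ofReal_norm f, ← Lp.norm_fourier_eq f, ofReal_norm, lintegral_enorm_sq]
  have hscale (ξ : Rn n) : ‖fourierHat f ξ‖ₑ ^ 2 =
      ENNReal.ofReal ((2 * Real.pi) ^ n)⁻¹ * ‖(𝓕 f : L2 n) ((2 * Real.pi)⁻¹ • ξ)‖ₑ ^ 2 := by
    simp only [← ofReal_norm, ← ENNReal.ofReal_pow (norm_nonneg _), norm_sq_fourierHat]
    rw [ENNReal.ofReal_mul (by positivity)]
  have hmeas : Measurable fun η => ‖(𝓕 f : L2 n) η‖ₑ ^ 2 :=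
    (Lp.stronglyMeasurable (𝓕 f : L2 n)).measurable.enorm.pow_const 2
  have hfactor : ((2 * Real.pi) ^ n)⁻¹ * |((2 * Real.pi)⁻¹ ^ n)⁻¹| = 1 := by
    rw [abs_of_pos (by positivity), inv_pow, inv_inv, inv_mul_cancel₀ (by positivity)]
  simp only [hscale]
  rw [lintegral_const_mul' _ _ ENNReal.ofReal_ne_top,
    ← lintegral_map hmeas (measurable_const_smul (2 * Real.pi)⁻¹),
    Measure.map_addHaar_smul _ (by positivity), lintegral_smul_measure, smul_eq_mul, ← mul_assoc,
    ← ENNReal.ofReal_mul (by positivity), finrank_euclideanSpace_fin, hfactor, ENNReal.ofReal_one,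
    one_mul, hfourier]

theorem fourierHat_ae_eq_zero_iff {f : L2 n} : (∀ᵐ ξ, fourierHat f ξ = 0) ↔ f = 0 := by
  rw [← enorm_eq_zero, ← pow_eq_zero_iff two_ne_zero, ← lintegral_enorm_sq_fourierHat,
    lintegral_eq_zero_iff ((measurable_fourierHat f).enorm.pow_const 2)]
  simp [EventuallyEq]

theorem enorm_sq_le_gevreyNormSq {d ν : ℝ} (hd : 0 ≤ d) (hν : 0 ≤ ν) (ε : ℝ) (f : L2 n) :
    ‖f‖ₑ ^ 2 ≤ gevreyNormSq d ν ε f := by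
  rw [← lintegral_enorm_sq_fourierHat, gevreyNormSq]
  refine lintegral_mono fun ξ => le_mul_of_one_le_left' (ENNReal.one_le_ofReal.2 ?_)
  have hweight : 1 ≤ (1 + ‖ξ‖ ^ 2) ^ d := Real.one_le_rpow (by simp) hd
  exact one_le_mul_of_one_le_of_one_le hweight (Real.one_le_exp (by positivity))

end FourierHat

section Solution

variable {n : ℕ} {T : ℝ} {a : ℝ → Matrix (Fin n) (Fin n) ℝ} {b : ℝ → Fin n → ℂ} {c : ℝ → ℂ}
  {u : ℝ → L2 n} {s t : ℝ}

theorem real_inner_mul_self_right (w z : ℂ) : inner ℝ z (w * z) = w.re * ‖z‖ ^ 2 := by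
  rw [Complex.inner, mul_assoc, Complex.mul_conj, Complex.re_mul_ofReal, Complex.normSq_eq_norm_sq]

theorem continuousOn_fourier {S : Set ℝ} (hu : ContinuousOn u S) :
    ContinuousOn (fun t => (𝓕 (u t) : L2 n)) S :=
  (FourierTransform.fourierCLM ℂ (L2 n)).continuous.comp_continuousOn hu

theorem contDiffOn_fourier {S : Set ℝ} (hu : ContDiffOn ℝ 1 u S) :
    ContDiffOn ℝ 1 (fun t => (𝓕 (u t) : L2 n)) S :=
  ((FourierTransform.fourierCLM ℂ (L2 n)).restrictScalars ℝ).contDiff.comp_contDiffOn hu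

theorem deriv_fourier (hu : DifferentiableAt ℝ u t) :
    deriv (fun t => (𝓕 (u t) : L2 n)) t = 𝓕 (deriv u t) :=
  (((FourierTransform.fourierCLM ℂ (L2 n)).restrictScalars ℝ).hasFDerivAt.comp_hasDerivAt t
    hu.hasDerivAt).deriv

namespace IsSolution

theorem ae_two_mul_inner_fourier_deriv (h : IsSolution T a b c u)
    (hu' : ContDiffOn ℝ 1 u (Ioo 0 T)) :
    ∀ᵐ t, t ∈ Ioo 0 T → ∀ᵐ η,
      2 * inner ℝ ((𝓕 (u t) : L2 n) η) (deriv (fun t => (𝓕 (u t) : L2 n)) t η) =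
        2 * (symbol (a t) (b t) (c t) ((2 * Real.pi) • η)).re * ‖(𝓕 (u t) : L2 n) η‖ ^ 2 := by
  filter_upwards [h] with t h ht
  have hdiff : DifferentiableAt ℝ u t :=
    (hu'.differentiableOn one_ne_zero).differentiableAt (isOpen_Ioo.mem_nhds ht)
  filter_upwards [ae_fourier_eq_symbol_mul (h ht)] with η hη
  rw [deriv_fourier hdiff, hη, real_inner_mul_self_right, mul_assoc]

variable {κ : Rn n → ℝ}

theorem ae_exp_mul_norm_sq_fourierHat_le (h : IsSolution T a b c u)
    (hu : ContinuousOn u (Icc 0 T)) (hu' : ContDiffOn ℝ 1 u (Ioo 0 T)) (hκ : Measurable κ)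
    (hsymbol : ∀ t ∈ Ioo 0 T, ∀ ξ, κ ξ ≤ 2 * (symbol (a t) (b t) (c t) ξ).re)
    (hs : 0 ≤ s) (hst : s ≤ t) (ht : t ≤ T) :
    ∀ᵐ ξ, Real.exp (κ ξ * (t - s)) * ‖fourierHat (u s) ξ‖ ^ 2 ≤ ‖fourierHat (u t) ξ‖ ^ 2 := by
  have hfourier := ae_exp_mul_norm_sq_le (hκ.comp (measurable_const_smul (2 * Real.pi))) hst
    ((continuousOn_fourier hu).mono (Icc_subset_Icc hs ht))
    ((contDiffOn_fourier hu').mono (Ioo_subset_Ioo hs ht)) <| by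
      filter_upwards [h.ae_two_mul_inner_fourier_deriv hu'] with τ hτ hτI
      filter_upwards [hτ (Ioo_subset_Ioo hs ht hτI)] with η hη
      rw [hη]
      exact mul_le_mul_of_nonneg_right (hsymbol τ (Ioo_subset_Ioo hs ht hτI) _) (sq_nonneg _)
  filter_upwards [(Measure.quasiMeasurePreserving_smul volume
    (inv_ne_zero Real.two_pi_pos.ne')).ae hfourier] with ξ hξ
  rw [Function.comp_apply, smul_inv_smul₀ Real.two_pi_pos.ne'] at hξ
  rw [norm_sq_fourierHat, norm_sq_fourierHat, mul_left_comm]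
  gcongr

theorem ae_norm_sq_fourierHat_le_exp_mul (h : IsSolution T a b c u)
    (hu : ContinuousOn u (Icc 0 T)) (hu' : ContDiffOn ℝ 1 u (Ioo 0 T)) (hκ : Measurable κ)
    (hsymbol : ∀ t ∈ Ioo 0 T, ∀ ξ, 2 * (symbol (a t) (b t) (c t) ξ).re ≤ κ ξ)
    (hs : 0 ≤ s) (hst : s ≤ t) (ht : t ≤ T) :
    ∀ᵐ ξ, ‖fourierHat (u t) ξ‖ ^ 2 ≤ Real.exp (κ ξ * (t - s)) * ‖fourierHat (u s) ξ‖ ^ 2 := by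
  have hfourier := ae_norm_sq_le_exp_mul (hκ.comp (measurable_const_smul (2 * Real.pi))) hst
    ((continuousOn_fourier hu).mono (Icc_subset_Icc hs ht))
    ((contDiffOn_fourier hu').mono (Ioo_subset_Ioo hs ht)) <| by
      filter_upwards [h.ae_two_mul_inner_fourier_deriv hu'] with τ hτ hτI
      filter_upwards [hτ (Ioo_subset_Ioo hs ht hτI)] with η hη
      rw [hη]
      exact mul_le_mul_of_nonneg_right (hsymbol τ (Ioo_subset_Ioo hs ht hτI) _) (sq_nonneg _)
  filter_upwards [(Measure.quasiMeasurePreserving_smul volume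
    (inv_ne_zero Real.two_pi_pos.ne')).ae hfourier] with ξ hξ
  rw [Function.comp_apply, smul_inv_smul₀ Real.two_pi_pos.ne'] at hξ
  rw [norm_sq_fourierHat, norm_sq_fourierHat, mul_left_comm]
  gcongr

theorem eq_zero_of_initial_eq_zero (h : IsSolution T a b c u)
    (hu : ContinuousOn u (Icc 0 T)) (hu' : ContDiffOn ℝ 1 u (Ioo 0 T)) (hκ : Measurable κ)
    (hsymbol : ∀ t ∈ Ioo 0 T, ∀ ξ, 2 * (symbol (a t) (b t) (c t) ξ).re ≤ κ ξ)
    (hu0 : u 0 = 0) (ht : t ∈ Icc 0 T) : u t = 0 := by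
  refine fourierHat_ae_eq_zero_iff.1 ?_
  filter_upwards [h.ae_norm_sq_fourierHat_le_exp_mul hu hu' hκ hsymbol le_rfl ht.1 ht.2,
    fourierHat_ae_eq_zero_iff.2 hu0] with ξ hξ hξ0
  rw [hξ0] at hξ
  simpa [sq_nonpos_iff] using hξ

end IsSolution

end Solution

section CoefficientBounds

variable {n : ℕ}

/-- The bounds of `IsAdmissible` on the coefficients of `𝓛` at one fixed time: ellipticity of `A`
with constant `kA`, and bounds `kB`, `kC` for the coefficients of lower order. -/
structure CoeffBounds (kA kB kC : ℝ) (A : Matrix (Fin n) (Fin n) ℝ) (β : Fin n → ℂ) (γ : ℂ) :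
    Prop where
  lower : ∀ ξ : Rn n, kA * ‖ξ‖ ^ 2 ≤ ∑ i, ∑ j, A i j * ξ i * ξ j
  upper : ∀ ξ : Rn n, ∑ i, ∑ j, A i j * ξ i * ξ j ≤ kA⁻¹ * ‖ξ‖ ^ 2
  bound_b : ∀ i, ‖β i‖ ≤ kB
  bound_c : ‖γ‖ ≤ kC

theorem IsAdmissible.coeffBounds {T kA kB kC : ℝ} {ω : ℝ → ℝ}
    {a : ℝ → Matrix (Fin n) (Fin n) ℝ} {b : ℝ → Fin n → ℂ} {c : ℝ → ℂ}
    (h : IsAdmissible T kA kB kC ω a b c) {t : ℝ} (ht : t ∈ Icc 0 T) :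
    CoeffBounds kA kB kC (a t) (b t) (c t) :=
  ⟨h.lower t ht, h.upper t ht, h.bound_b t ht, h.bound_c t ht⟩

theorem norm_sum_mul_coord_le {β : Fin n → ℂ} {kB : ℝ} (hβ : ∀ i, ‖β i‖ ≤ kB) (ξ : Rn n) :
    ‖∑ j, β j * ξ j‖ ≤ n * kB * ‖ξ‖ := by
  have hterm (j : Fin n) : ‖β j * ξ j‖ ≤ kB * ‖ξ‖ := by
    rw [norm_mul, Complex.norm_real]
    exact mul_le_mul (hβ j) (PiLp.norm_apply_le ξ j) (norm_nonneg _) ((norm_nonneg _).trans (hβ j))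
  calc ‖∑ j, β j * ξ j‖ ≤ ∑ _j : Fin n, kB * ‖ξ‖ := norm_sum_le_of_le _ fun j _ => hterm j
    _ = n * kB * ‖ξ‖ := by simp [mul_assoc]

namespace CoeffBounds

variable {kA kB kC : ℝ} {A : Matrix (Fin n) (Fin n) ℝ} {β : Fin n → ℂ} {γ : ℂ}

theorem abs_symbol_re_sub_le (h : CoeffBounds kA kB kC A β γ) (ξ : Rn n) :
    |(symbol A β γ ξ).re - ∑ i, ∑ j, A i j * ξ i * ξ j| ≤ n * kB * ‖ξ‖ + kC := by
  have hlower : (symbol A β γ ξ).re - ∑ i, ∑ j, A i j * ξ i * ξ j =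
      -(Complex.I * ∑ j, β j * ξ j + γ).re := by
    rw [symbol, Complex.sub_re, Complex.sub_re, Complex.ofReal_re, Complex.add_re]
    ring
  rw [hlower, abs_neg]
  calc |(Complex.I * ∑ j, β j * ξ j + γ).re| ≤ ‖Complex.I * ∑ j, β j * ξ j‖ + ‖γ‖ :=
        (Complex.abs_re_le_norm _).trans (norm_add_le _ _)
    _ ≤ n * kB * ‖ξ‖ + kC := by
        rw [norm_mul, Complex.norm_I, one_mul]
        exact add_le_add (norm_sum_mul_coord_le h.bound_b ξ) h.bound_c

theorem le_two_mul_symbol_re (h : CoeffBounds kA kB kC A β γ) (hkA : 0 < kA) (ξ : Rn n) :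
    kA * ‖ξ‖ ^ 2 - (2 * kC + (n * kB) ^ 2 / kA) ≤ 2 * (symbol A β γ ξ).re := by
  have hyoung : 2 * (n * kB * ‖ξ‖) ≤ kA * ‖ξ‖ ^ 2 + (n * kB) ^ 2 / kA := by
    have hsq : kA * ‖ξ‖ ^ 2 + (n * kB) ^ 2 / kA - 2 * (n * kB * ‖ξ‖) =
        (kA * ‖ξ‖ - n * kB) ^ 2 / kA := by field_simp; ring
    have : 0 ≤ (kA * ‖ξ‖ - n * kB) ^ 2 / kA := by positivity
    linarith
  linarith [(abs_le.1 (h.abs_symbol_re_sub_le ξ)).1, h.lower ξ]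

theorem two_mul_symbol_re_le (h : CoeffBounds kA kB kC A β γ) (hkA : 0 < kA) (hkB : 0 ≤ kB)
    (ξ : Rn n) :
    2 * (symbol A β γ ξ).re ≤ 2 * (kA⁻¹ + n * kB + kC) * (1 + ‖ξ‖ ^ 2) := by
  have hkC : 0 ≤ kC := (norm_nonneg _).trans h.bound_c
  have hnorm : ‖ξ‖ ≤ 1 + ‖ξ‖ ^ 2 := by nlinarith [sq_nonneg (‖ξ‖ - 1)]
  have hfirst : n * kB * ‖ξ‖ ≤ n * kB * (1 + ‖ξ‖ ^ 2) := by gcongr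
  have hzeroth : 0 ≤ kC * ‖ξ‖ ^ 2 := by positivity
  have hinv : 0 < kA⁻¹ := inv_pos.2 hkA
  linarith [(abs_le.1 (h.abs_symbol_re_sub_le ξ)).2, h.upper ξ]

end CoeffBounds

end CoefficientBounds

section Stability

theorem one_add_mul_le_of_exp_growth {r s K z σ p q : ℝ} (hr : 0 ≤ r) (hrs : r ≤ s) (hK : 0 ≤ K)
    (hz : 0 ≤ z) (hzσ : z ≤ σ) (hp : 0 ≤ p) (h : q ≤ Real.exp (K * (1 + r) * z) * p) :
    (1 + r) * q ≤ Real.exp ((K * σ + 1) * (1 + s)) * p := by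
  have hs : 0 ≤ s := hr.trans hrs
  have hweight : 1 + r ≤ Real.exp (1 + s) := by linarith [Real.add_one_le_exp (1 + s)]
  calc (1 + r) * q ≤ (1 + r) * (Real.exp (K * (1 + r) * z) * p) := by gcongr
    _ ≤ Real.exp (1 + s) * (Real.exp (K * (1 + s) * σ) * p) := by gcongr
    _ = Real.exp ((K * σ + 1) * (1 + s)) * p := by
        rw [← mul_assoc, ← Real.exp_add]
        ring_nf

theorem le_exp_mul_of_exp_decay {r s l D z τ σ q w : ℝ} (hs : 0 ≤ s) (hsr : s ≤ r) (hl : 0 ≤ l)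
    (hD : 0 ≤ D) (hz : 0 ≤ z) (hzτ : z ≤ τ) (hτσ : τ ≤ σ) (hw : 0 ≤ w)
    (h : Real.exp ((l * r - D) * (σ - z)) * q ≤ w) :
    q ≤ Real.exp (D * σ - l * (σ - τ) * s) * w := by
  have hdecay : l * (σ - τ) * s ≤ l * r * (σ - z) := by
    rw [mul_right_comm]
    exact mul_le_mul (mul_le_mul_of_nonneg_left hsr hl) (sub_le_sub_left hzτ σ)
      (sub_nonneg.2 hτσ) (mul_nonneg hl (hs.trans hsr))
  calc q = Real.exp (-((l * r - D) * (σ - z))) * (Real.exp ((l * r - D) * (σ - z)) * q) := by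
        rw [← mul_assoc, ← Real.exp_add, neg_add_cancel, Real.exp_zero, one_mul]
    _ ≤ Real.exp (-((l * r - D) * (σ - z))) * w := by gcongr
    _ ≤ Real.exp (D * σ - l * (σ - τ) * s) * w := by
        gcongr
        linarith [mul_nonneg hD hz]

theorem exists_exp_mul_le_rpow_min {B m y : ℝ} (hB : 0 < B) (hy : 0 < y)
    (hyB : y ≤ Real.exp (-(2 * B))) :
    ∃ s, 0 ≤ s ∧ Real.exp (B * (1 + s)) * y ≤ y ^ min (1 / 2) (m / (2 * B)) ∧
      Real.exp (-(m * s)) ≤ Real.exp m * y ^ min (1 / 2) (m / (2 * B)) := by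
  have hlog : Real.log y ≤ -(2 * B) := (Real.log_le_iff_le_exp hy).2 hyB
  have hlog0 : Real.log y ≤ 0 := by linarith
  -- The choice `exp (B * (1 + s)) = y ^ (-1 / 2)`.
  refine ⟨-Real.log y / (2 * B) - 1, ?_, ?_, ?_⟩
  · rw [sub_nonneg, le_div_iff₀ (by positivity)]
    linarith
  · have hhalf : Real.exp (B * (1 + (-Real.log y / (2 * B) - 1))) * y = y ^ (1 / 2 : ℝ) := by
      rw [Real.rpow_def_of_pos hy]
      nth_rw 2 [← Real.exp_log hy]
      rw [← Real.exp_add]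
      congr 1
      field_simp
      ring
    rw [hhalf, Real.rpow_def_of_pos hy, Real.rpow_def_of_pos hy]
    exact Real.exp_le_exp.2 (mul_le_mul_of_nonpos_left (min_le_left _ _) hlog0)
  · have hdecay : -(m * (-Real.log y / (2 * B) - 1)) = m + Real.log y * (m / (2 * B)) := by
      field_simp
      ring
    rw [hdecay, Real.exp_add, Real.rpow_def_of_pos hy]
    refine mul_le_mul_of_nonneg_left (Real.exp_le_exp.2 ?_) (Real.exp_pos _).le
    exact mul_le_mul_of_nonpos_left (min_le_right _ _) hlog0

variable {n : ℕ} {T : ℝ} {a : ℝ → Matrix (Fin n) (Fin n) ℝ} {b : ℝ → Fin n → ℂ} {c : ℝ → ℂ}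
  {u : ℝ → L2 n} {l D K z τ σ : ℝ}

namespace IsSolution

theorem sobolevNormSq_le_add (h : IsSolution T a b c u) (hu : ContinuousOn u (Icc 0 T))
    (hu' : ContDiffOn ℝ 1 u (Ioo 0 T)) (hl : 0 ≤ l) (hD : 0 ≤ D) (hK : 0 ≤ K)
    (hlower : ∀ t ∈ Ioo 0 T, ∀ ξ, l * ‖ξ‖ ^ 2 - D ≤ 2 * (symbol (a t) (b t) (c t) ξ).re)
    (hupper : ∀ t ∈ Ioo 0 T, ∀ ξ, 2 * (symbol (a t) (b t) (c t) ξ).re ≤ K * (1 + ‖ξ‖ ^ 2))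
    (hz : 0 ≤ z) (hzτ : z ≤ τ) (hτσ : τ ≤ σ) (hσT : σ ≤ T) {s : ℝ} (hs : 0 ≤ s) :
    sobolevNormSq (u z) ≤ ENNReal.ofReal (Real.exp ((K * σ + 1) * (1 + s))) * ‖u 0‖ₑ ^ 2 +
      ENNReal.ofReal (Real.exp (D * σ - l * (σ - τ) * s)) * sobolevNormSq (u σ) := by
  have hzσ : z ≤ σ := hzτ.trans hτσ
  have hmeas : Measurable fun ξ => ‖fourierHat (u 0) ξ‖ₑ ^ 2 :=
    (measurable_fourierHat (u 0)).enorm.pow_const 2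
  rw [sobolevNormSq, sobolevNormSq, ← lintegral_enorm_sq_fourierHat,
    ← lintegral_const_mul' _ _ ENNReal.ofReal_ne_top,
    ← lintegral_const_mul' _ _ ENNReal.ofReal_ne_top, ← lintegral_add_left (hmeas.const_mul _)]
  refine lintegral_mono_ae ?_
  filter_upwards [
    h.ae_norm_sq_fourierHat_le_exp_mul hu hu' (by fun_prop) hupper le_rfl hz (hzσ.trans hσT),
    h.ae_exp_mul_norm_sq_fourierHat_le hu hu' (by fun_prop) hlower hz hzσ hσT] with ξ hgrowth hdecay
  have hξ : 0 ≤ 1 + ‖ξ‖ ^ 2 := by positivity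
  simp only [← ofReal_norm, ← ENNReal.ofReal_pow (norm_nonneg _)]
  rw [← ENNReal.ofReal_mul hξ, ← ENNReal.ofReal_mul hξ]
  simp only [← ENNReal.ofReal_mul (Real.exp_pos _).le]
  rcases le_total (‖ξ‖ ^ 2) s with hlow | hhigh
  · rw [sub_zero] at hgrowth
    exact le_add_right (ENNReal.ofReal_le_ofReal
      (one_add_mul_le_of_exp_growth (sq_nonneg _) hlow hK hz hzσ (sq_nonneg _) hgrowth))
  · refine le_add_left (ENNReal.ofReal_le_ofReal ?_)
    rw [mul_left_comm]
    exact mul_le_mul_of_nonneg_left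
      (le_exp_mul_of_exp_decay hs hhigh hl hD hz hzτ hτσ (sq_nonneg _) hdecay) hξ

theorem sobolevNormSq_le_rpow (h : IsSolution T a b c u) (hu : ContinuousOn u (Icc 0 T))
    (hu' : ContDiffOn ℝ 1 u (Ioo 0 T)) (hl : 0 ≤ l) (hD : 0 ≤ D) (hK : 0 ≤ K)
    (hlower : ∀ t ∈ Ioo 0 T, ∀ ξ, l * ‖ξ‖ ^ 2 - D ≤ 2 * (symbol (a t) (b t) (c t) ξ).re)
    (hupper : ∀ t ∈ Ioo 0 T, ∀ ξ, 2 * (symbol (a t) (b t) (c t) ξ).re ≤ K * (1 + ‖ξ‖ ^ 2))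
    (hz : 0 ≤ z) (hzτ : z ≤ τ) (hτσ : τ ≤ σ) (hσT : σ ≤ T) {y : ℝ} (hy : 0 < y)
    (hyB : y ≤ Real.exp (-(2 * (K * σ + 1)))) (hu0 : ‖u 0‖ₑ ^ 2 ≤ ENNReal.ofReal y) :
    sobolevNormSq (u z) ≤
      ENNReal.ofReal (Real.exp (D * σ + l * (σ - τ)) *
        y ^ min (1 / 2) (l * (σ - τ) / (2 * (K * σ + 1)))) * (1 + sobolevNormSq (u σ)) := by
  have hσ : 0 ≤ σ := hz.trans (hzτ.trans hτσ)
  obtain ⟨s, hs, hlow, hhigh⟩ := exists_exp_mul_le_rpow_min (m := l * (σ - τ))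
    (by positivity) hy hyB
  have hC : 1 ≤ Real.exp (D * σ + l * (σ - τ)) :=
    Real.one_le_exp (add_nonneg (by positivity) (mul_nonneg hl (sub_nonneg.2 hτσ)))
  refine (h.sobolevNormSq_le_add hu hu' hl hD hK hlower hupper hz hzτ hτσ hσT hs).trans ?_
  rw [mul_add (ENNReal.ofReal _), mul_one]
  refine add_le_add ?_ (mul_le_mul_left (ENNReal.ofReal_le_ofReal ?_) _)
  · refine (mul_le_mul_right hu0 _).trans ?_
    rw [← ENNReal.ofReal_mul (Real.exp_pos _).le]
    exact ENNReal.ofReal_le_ofReal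
      (hlow.trans (le_mul_of_one_le_left (Real.rpow_nonneg hy.le _) hC))
  · rw [sub_eq_add_neg, Real.exp_add, Real.exp_add, mul_assoc (Real.exp (D * σ))]
    exact mul_le_mul_of_nonneg_left hhigh (Real.exp_pos _).le

end IsSolution

end Stability

section LogModulus

/-- The modulus of the stability estimate: the Hölder bound `y ^ θ` is `k ^ θ * exp (-σ g)` for
`g = logModulus θ σ k y`, and the constant `k` makes `g` nonnegative on `]0, k]`. -/
noncomputable def logModulus (θ σ k y : ℝ) : ℝ := θ / σ * (Real.log k - Real.log y)

variable {θ σ k : ℝ}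

theorem logModulus_nonneg (hθ : 0 ≤ θ) (hσ : 0 ≤ σ) {y : ℝ} (hy : y ∈ Ioc 0 k) :
    0 ≤ logModulus θ σ k y :=
  mul_nonneg (by positivity) (sub_nonneg.2 (Real.log_le_log hy.1 hy.2))

theorem strictAntiOn_logModulus (hθ : 0 < θ) (hσ : 0 < σ) (k : ℝ) :
    StrictAntiOn (logModulus θ σ k) (Ioi 0) := fun _x hx _y _hy hxy =>
  mul_lt_mul_of_pos_left (sub_lt_sub_left (Real.log_lt_log hx hxy) _) (by positivity)

theorem tendsto_logModulus_nhdsGT_zero (hθ : 0 < θ) (hσ : 0 < σ) (k : ℝ) :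
    Tendsto (logModulus θ σ k) (𝓝[>] 0) atTop := by
  refine Tendsto.const_mul_atTop (by positivity) ?_
  simp only [sub_eq_add_neg]
  exact tendsto_atTop_add_const_left _ _
    (tendsto_neg_atBot_atTop.comp Real.tendsto_log_nhdsGT_zero)

theorem rpow_mul_exp_neg_mul_logModulus (hσ : σ ≠ 0) (hk : 0 < k) {y : ℝ} (hy : 0 < y) :
    k ^ θ * Real.exp (-σ * logModulus θ σ k y) = y ^ θ := by
  rw [Real.rpow_def_of_pos hk, Real.rpow_def_of_pos hy, ← Real.exp_add, logModulus]
  congr 1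
  field_simp
  ring

end LogModulus

end BackwardParabolic

open BackwardParabolic in
theorem mainTheorem2_general (n : ℕ) {kA kB kC τ σ : ℝ} (hkA : 0 < kA) (hkB : 0 ≤ kB)
    (hkC : 0 ≤ kC) (hτ : 0 ≤ τ) (hτσ : τ < σ) :
    ∃ ρ C : ℝ, 0 < ρ ∧ ρ ≤ kA ∧ 0 < C ∧ ∃ g : ℝ → ℝ,
      (∀ y ∈ Ioc 0 kA, 0 ≤ g y) ∧ StrictAntiOn g (Ioc 0 kA) ∧ Tendsto g (𝓝[>] 0) atTop ∧
      ∀ (T : ℝ) (a : ℝ → Matrix (Fin n) (Fin n) ℝ) (b : ℝ → Fin n → ℂ) (c : ℝ → ℂ) (u : ℝ → L2 n)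
        (y : ℝ≥0∞), σ ≤ T → (∀ t ∈ Ioo 0 T, CoeffBounds kA kB kC (a t) (b t) (c t)) →
        ContinuousOn u (Icc 0 T) → ContDiffOn ℝ 1 u (Ioo 0 T) → IsSolution T a b c u →
        ‖u 0‖ₑ ^ 2 ≤ y → y < ENNReal.ofReal ρ →
        (y ≠ 0 → ⨆ z ∈ Icc 0 τ, sobolevNormSq (u z) ≤
          ENNReal.ofReal (C * Real.exp (-σ * g y.toReal)) * (1 + sobolevNormSq (u σ))) ∧
        (y = 0 → ∀ z ∈ Icc 0 τ, u z = 0) := by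
  have hσ : 0 < σ := hτ.trans_lt hτσ
  have hdiff : 0 < σ - τ := sub_pos.2 hτσ
  let D := 2 * kC + (n * kB) ^ 2 / kA
  let K := 2 * (kA⁻¹ + n * kB + kC)
  let θ := min (1 / 2) (kA * (σ - τ) / (2 * (K * σ + 1)))
  have hθ : 0 < θ := lt_min one_half_pos (div_pos (mul_pos hkA hdiff) (by positivity))
  refine ⟨min kA (Real.exp (-(2 * (K * σ + 1)))), Real.exp (D * σ + kA * (σ - τ)) * kA ^ θ,
    by positivity, min_le_left _ _, by positivity, logModulus θ σ kA,
    fun y hy => logModulus_nonneg hθ.le hσ.le hy,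
    (strictAntiOn_logModulus hθ hσ kA).mono Ioc_subset_Ioi_self,
    tendsto_logModulus_nhdsGT_zero hθ hσ kA, fun T a b c u y hσT hcoeff hu hu' h hu0 hy => ?_⟩
  have hlower := fun t ht => (hcoeff t ht).le_two_mul_symbol_re hkA
  have hupper := fun t ht => (hcoeff t ht).two_mul_symbol_re_le hkA hkB
  refine ⟨fun hy0 => iSup₂_le fun z hz => ?_, fun hy0 z hz => ?_⟩
  · have hy_top : y ≠ ∞ := hy.ne_top
    have hy_pos : 0 < y.toReal := ENNReal.toReal_pos hy0 hy_top
    rw [mul_assoc, rpow_mul_exp_neg_mul_logModulus hσ.ne' hkA hy_pos]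
    exact h.sobolevNormSq_le_rpow hu hu' hkA.le (by positivity) (by positivity) hlower hupper
      hz.1 hz.2 hτσ.le hσT hy_pos
      (((ENNReal.lt_ofReal_iff_toReal_lt hy_top).1 hy).le.trans (min_le_right _ _))
      (hu0.trans (ENNReal.ofReal_toReal hy_top).ge)
  · exact h.eq_zero_of_initial_eq_zero hu hu' (by fun_prop) hupper
      (by simpa [hy0] using hu0) ⟨hz.1, hz.2.trans (hτσ.le.trans hσT)⟩

theorem mainTheorem2 (n : ℕ) (kA kB kC : ℝ) (hkA : 0 < kA) (hkB : 0 < kB) (hkC : 0 < kC)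
    (ω : ℝ → ℝ) (hω : BackwardParabolic.IsModulusOfContinuity ω)
    (hωO : BackwardParabolic.Osgood ω) :
    ∃ α₁ : ℝ, 0 < α₁ ∧
      ∀ T T'' : ℝ, 0 < T'' → T'' < T →
        ∃ ρ C : ℝ, 0 < ρ ∧ ρ ≤ kA ∧ 0 < C ∧
          ∀ ν ε : ℝ, 0 < ν → 1 < ε →
            ∃ g : ℝ → ℝ,
              (∀ y ∈ Ioc 0 kA, 0 ≤ g y) ∧
              StrictAntiOn g (Ioc 0 kA) ∧
              Tendsto g (𝓝[>] 0) atTop ∧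
              ∀ (a : ℝ → Matrix (Fin n) (Fin n) ℝ) (b : ℝ → Fin n → ℂ) (c : ℝ → ℂ)
                (u : ℝ → BackwardParabolic.L2 n) (σ : ℝ) (y : ℝ≥0∞),
                BackwardParabolic.IsAdmissible T kA kB kC ω a b c →
                BackwardParabolic.MemH0 T u →
                BackwardParabolic.IsSolution T a b c u →
                σ = min T'' (1 / α₁) →
                y = BackwardParabolic.gevreyNormSq 0 ν ε (u 0) →
                y < ENNReal.ofReal ρ →
                (y ≠ 0 →
                  (⨆ z ∈ Icc 0 (σ / 8), BackwardParabolic.sobolevNormSq (u z)) ≤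
                    ENNReal.ofReal (C * Real.exp (-σ * g y.toReal)) *
                      (1 + BackwardParabolic.sobolevNormSq (u σ))) ∧
                (y = 0 → ∀ z ∈ Icc 0 (σ / 8), u z = 0) := by
  refine ⟨1, one_pos, fun T T'' hT'' hT => ?_⟩
  have hσ : 0 < min T'' (1 / 1) := lt_min hT'' (by norm_num)
  obtain ⟨ρ, C, hρ, hρkA, hC, g, hg0, hg, hg', hbound⟩ := mainTheorem2_general n hkA hkB.le hkC.le
    (div_nonneg hσ.le (by norm_num)) (div_lt_self hσ (by norm_num : (1 : ℝ) < 8))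
  refine ⟨ρ, C, hρ, hρkA, hC, fun ν ε hν _ => ⟨g, hg0, hg, hg', ?_⟩⟩
  rintro a b c u _ _ h hu hsol rfl rfl hy
  exact hbound T a b c u _ ((min_le_left _ _).trans hT.le)
    (fun t ht => h.coeffBounds (Ioo_subset_Icc_self ht)) hu.continuousOn
    (hu.contDiffOn.mono Ioo_subset_Ico_self) hsol
    (BackwardParabolic.enorm_sq_le_gevreyNormSq le_rfl hν.le ε (u 0)) hy
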